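/- Let $n \ge 1$ agents $A_1,\dots,A_n$ initially share a finite collection of EPR pairs, each in the state $(|00\rangle+|11\rangle)/\sqrt2$ with its two qubits held by two different agents (two agents may share several pairs), and no other entanglement. The EPR graph of the agents has the agents as vertices, and two distinct agents are joined by an edge if and only if they share an EPR pair. If the $n$-partite maximally entangled state $(|00\cdots0\rangle+|11\cdots1\rangle)/\sqrt2$, in which each agent holds one qubit, can be prepared from the shared EPR pairs with certainty by a finite protocol of local operations and classical communication (arbitrary quantum instruments applied by the agents to their own systems, local ancillas and discarding allowed, with all later operations possibly depending on the broadcast outcomes, and no quantum communication), then the EPR graph is connected. -/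

import Mathlib

/-- Operators on the joint system of the agents in `V`, where agent `v` holds a quantum system
with orthonormal basis indexed by the finite type `A v`.  The joint system is the tensor product
of the local systems; its product basis is indexed by `∀ v, A v`. -/
abbrev JointOp {V : Type*} (A : V → Type) : Type _ :=
  Matrix (∀ v, A v) (∀ v, A v) ℂ

/-- The density operator `|ψ⟩⟨ψ|` of the state vector `ψ`. -/
noncomputable def pureState {V : Type*} {A : V → Type} (ψ : (∀ v, A v) → ℂ) : JointOp A :=
  Matrix.vecMulVec ψ (star ψ)

/-- The tensor product `⨂ v, K v` of local operators, one for each agent. -/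
noncomputable def tensorOp {V : Type*} [Fintype V] {A B : V → Type}
    (K : ∀ v, Matrix (B v) (A v) ℂ) : Matrix (∀ v, B v) (∀ v, A v) ℂ :=
  Matrix.of fun b a => ∏ v, K v (b v) (a v)

/-- A quantum instrument from a system with basis `a` to a system with basis `b`, in Kraus form:
a general measurement with finitely many classical outcomes.  On outcome `o` the (unnormalised)
state `ρ` becomes `∑ k, K o k * ρ * (K o k)ᴴ`.  The systems `a` and `b` may differ, so that adding
ancillas, unitaries, measurements and discarding subsystems are all covered. -/
structure LocalInstrument (a b : Type) [Fintype a] [DecidableEq a] [Fintype b] where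
  outcomes : ℕ
  krausCount : ℕ
  kraus : Fin outcomes → Fin krausCount → Matrix b a ℂ
  complete : ∑ o, ∑ k, (kraus o k).conjTranspose * kraus o k = 1

/-- The (unnormalised) joint state after each agent `v` has applied its instrument `I v` to its
own system and obtained the classical outcome `o v`. -/
noncomputable def outcomeMap {V : Type*} [Fintype V] [DecidableEq V] {A B : V → Type}
    [∀ v, Fintype (A v)] [∀ v, DecidableEq (A v)] [∀ v, Fintype (B v)]
    (I : ∀ v, LocalInstrument (A v) (B v)) (o : ∀ v, Fin (I v).outcomes)
    (ρ : JointOp A) : JointOp B :=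
  ∑ k : ∀ v, Fin (I v).krausCount,
    tensorOp (fun v => (I v).kraus (o v) (k v)) * ρ *
      (tensorOp (fun v => (I v).kraus (o v) (k v))).conjTranspose

/-- `IsLOCC Φ`: the map `Φ` on joint states is implemented by a finite protocol of local operations
and classical communication.  The protocol either stops, or performs a round: every agent applies
an instrument to its own system (possibly a trivial one) and broadcasts the outcome, and the agents
go on with a protocol that may depend on all the broadcast outcomes. -/
inductive IsLOCC {V : Type*} [Fintype V] [DecidableEq V] {C : V → Type}
    [∀ v, Fintype (C v)] [∀ v, DecidableEq (C v)] :
    ∀ {A : V → Type} [∀ v, Fintype (A v)] [∀ v, DecidableEq (A v)],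
      (JointOp A → JointOp C) → Prop
  | stop_here : IsLOCC (fun ρ : JointOp C => ρ)
  | round {A B : V → Type} [∀ v, Fintype (A v)] [∀ v, DecidableEq (A v)]
      [∀ v, Fintype (B v)] [∀ v, DecidableEq (B v)]
      (I : ∀ v, LocalInstrument (A v) (B v))
      (Φ : (∀ v, Fin (I v).outcomes) → JointOp B → JointOp C)
      (hΦ : ∀ o, IsLOCC (Φ o)) :
      IsLOCC (fun ρ : JointOp A => ∑ o, Φ o (outcomeMap I o ρ))

/-- A finite distribution of EPR pairs among the agents in `V`: the halves of pair `e` are held by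
the two distinct agents `left e` and `right e`.  Two agents may share several pairs. -/
structure EPRNetwork (V : Type*) where
  numPairs : ℕ
  left : Fin numPairs → V
  right : Fin numPairs → V
  left_ne_right : ∀ e, left e ≠ right e

namespace EPRNetwork

variable {V : Type*} (N : EPRNetwork V)

/-- The EPR graph: distinct agents are adjacent if and only if they share an EPR pair. -/
def eprGraph : SimpleGraph V where
  Adj u v := ∃ e, (N.left e = u ∧ N.right e = v) ∨ (N.left e = v ∧ N.right e = u)
  symm := ⟨fun _ _ ⟨e, he⟩ => ⟨e, he.symm⟩⟩
  loopless := ⟨fun _ ⟨e, he⟩ =>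
    N.left_ne_right e (he.elim (fun h => h.1.trans h.2.symm) (fun h => h.1.trans h.2.symm))⟩

/-- The agent holding a given qubit; `(e, 0)` and `(e, 1)` are the two halves of pair `e`. -/
def holder (q : Fin N.numPairs × Fin 2) : V :=
  if q.2 = 0 then N.left q.1 else N.right q.1

/-- The qubits initially held by agent `v`. -/
abbrev Qubits (v : V) : Type := {q : Fin N.numPairs × Fin 2 // N.holder q = v}

/-- The computational basis of the qubits initially held by agent `v`. -/
abbrev LocalBasis (v : V) : Type := N.Qubits v → Fin 2

/-- The initial state vector of the network: the tensor product over all pairs `e` of the EPR state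
`(|00⟩ + |11⟩) / √2` on the two halves of `e`. -/
noncomputable def eprState (x : ∀ v, N.LocalBasis v) : ℂ :=
  ∏ e : Fin N.numPairs,
    if x _ ⟨(e, 0), rfl⟩ = x _ ⟨(e, 1), rfl⟩ then ((1 / Real.sqrt 2 : ℝ) : ℂ) else 0

end EPRNetwork

/-- The state vector `(|00…0⟩ + |11…1⟩) / √2`, in which each agent holds one qubit. -/
noncomputable def ghzState (V : Type*) [Fintype V] (x : V → Fin 2) : ℂ :=
  ((1 / Real.sqrt 2 : ℝ) : ℂ) *
    ((if ∀ v, x v = 0 then 1 else 0) + (if ∀ v, x v = 1 then 1 else 0))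

/-- The state `(|00…0⟩ + |11…1⟩) / √2` can be prepared from the EPR pairs of the network by local
operations and classical communication, with no quantum communication. -/
def EPRNetwork.CanPrepareGHZ {V : Type*} [Fintype V] [DecidableEq V] (N : EPRNetwork V) : Prop :=
  ∃ Φ : JointOp N.LocalBasis → JointOp (fun _ : V => Fin 2),
    IsLOCC Φ ∧ Φ (pureState N.eprState) = pureState (ghzState V)

/-! If the EPR graph is disconnected, the component of a vertex gives a cut that no pair crosses, so
the initial state is a product across it. Kraus operators that are tensor products keep the cone of
separable states stable, hence so does every LOCC protocol. GHZ lies outside the cone: by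
`two_mul_norm_apply_le_of_mem_separableCone`, its coherence between all-0 and all-1 would be bounded
by populations of mixed strings, which vanish. -/

/-- The vector `ψ` is a product of a vector of the agents satisfying `p` and a vector of the other
agents. -/
def IsProductAcross {V : Type*} {A : V → Type} (p : V → Prop) (ψ : (∀ v, A v) → ℂ) : Prop :=
  ∃ (f : (∀ v : {v // p v}, A v) → ℂ) (g : (∀ v : {v // ¬ p v}, A v) → ℂ),
    ∀ x, ψ x = f (fun v => x v) * g (fun v => x v)

/-- The cone of (unnormalised) states separable across the cut between the agents satisfying `p`
and the other agents. -/
def separableCone {V : Type*} (A : V → Type) (p : V → Prop) : AddSubmonoid (JointOp A) :=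
  AddSubmonoid.closure {ρ | ∃ ψ : (∀ v, A v) → ℂ, IsProductAcross p ψ ∧ ρ = pureState ψ}

/-- A tensor product of local operators splits into one operator per side of the cut, each acting on
its own factor. -/
theorem IsProductAcross.tensorOp_mulVec {V : Type*} [Fintype V] [DecidableEq V] {A B : V → Type}
    [∀ v, Fintype (A v)] {p : V → Prop} {ψ : (∀ v, A v) → ℂ} (hψ : IsProductAcross p ψ)
    (K : ∀ v, Matrix (B v) (A v) ℂ) :
    IsProductAcross p ((tensorOp K).mulVec ψ) := by
  classical
  obtain ⟨f, g, h⟩ := hψ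
  refine ⟨fun (b : ∀ v : {v // p v}, B v) => ∑ a : ∀ v : {v // p v}, A v,
      (∏ v : {v // p v}, K v (b v) (a v)) * f a,
    fun (b : ∀ v : {v // ¬ p v}, B v) => ∑ a : ∀ v : {v // ¬ p v}, A v,
      (∏ v : {v // ¬ p v}, K v (b v) (a v)) * g a, fun b => ?_⟩
  rw [Finset.sum_mul_sum, ← Fintype.sum_prod_type', Matrix.mulVec, dotProduct]
  refine Fintype.sum_equiv (Equiv.piEquivPiSubtypeProd p A) _ _ fun a => ?_
  simp only [tensorOp, Matrix.of_apply, Equiv.piEquivPiSubtypeProd_apply, h]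
  rw [← Fintype.prod_subtype_mul_prod_subtype p]
  ring

theorem mul_pureState_mul_conjTranspose {V : Type*} {A B : V → Type} [Fintype (∀ v, A v)]
    (M : Matrix (∀ v, B v) (∀ v, A v) ℂ) (ψ : (∀ v, A v) → ℂ) :
    M * pureState ψ * M.conjTranspose = pureState (M.mulVec ψ) := by
  rw [pureState, pureState, Matrix.mul_vecMulVec, Matrix.vecMulVec_mul, Matrix.star_mulVec]

/-- Conjugation by a Kraus operator is additive and sends each pure product generator to another; no
normalisation is needed in a cone. -/
theorem outcomeMap_mem_separableCone {V : Type*} [Fintype V] [DecidableEq V] {A B : V → Type}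
    [∀ v, Fintype (A v)] [∀ v, DecidableEq (A v)] [∀ v, Fintype (B v)] {p : V → Prop}
    (I : ∀ v, LocalInstrument (A v) (B v)) (o : ∀ v, Fin (I v).outcomes)
    {ρ : JointOp A} (hρ : ρ ∈ separableCone A p) :
    outcomeMap I o ρ ∈ separableCone B p := by
  refine AddSubmonoid.sum_mem _ fun k _ => ?_
  induction hρ using AddSubmonoid.closure_induction with
  | mem ρ h =>
    obtain ⟨ψ, hψ, rfl⟩ := h
    exact AddSubmonoid.subset_closure
      ⟨_, hψ.tensorOp_mulVec _, mul_pureState_mul_conjTranspose _ _⟩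
  | zero => simp [zero_mem]
  | add ρ σ _ _ h₁ h₂ =>
    rw [Matrix.mul_add, Matrix.add_mul]
    exact add_mem h₁ h₂

/-- Local operations and classical communication preserve separability across a cut. -/
theorem IsLOCC.mem_separableCone {V : Type*} [Fintype V] [DecidableEq V] {A C : V → Type}
    [∀ v, Fintype (C v)] [∀ v, DecidableEq (C v)] [∀ v, Fintype (A v)] [∀ v, DecidableEq (A v)]
    {Φ : JointOp A → JointOp C} (hΦ : IsLOCC Φ) (p : V → Prop) {ρ : JointOp A}
    (hρ : ρ ∈ separableCone A p) : Φ ρ ∈ separableCone C p := by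
  induction hΦ with
  | stop_here => exact hρ
  | round I Φ _ ih =>
    exact AddSubmonoid.sum_mem _ fun o _ => ih o (outcomeMap_mem_separableCone I o hρ)

/-- Exchanging the coordinates satisfying `p` between `x` and `y` bounds the coherence between `x`
and `y` in a separable state by populations. -/
theorem two_mul_norm_apply_le_of_mem_separableCone {V : Type*} {A : V → Type} {p : V → Prop}
    [DecidablePred p] {ρ : JointOp A} (hρ : ρ ∈ separableCone A p) (x y : ∀ v, A v) :
    2 * ‖ρ x y‖ ≤
      (ρ (fun v => if p v then x v else y v) (fun v => if p v then x v else y v)).re +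
      (ρ (fun v => if p v then y v else x v) (fun v => if p v then y v else x v)).re := by
  induction hρ using AddSubmonoid.closure_induction with
  | mem ρ h =>
    obtain ⟨ψ, ⟨f, g, h⟩, rfl⟩ := h
    -- Both sides are the product of the same four values of `f` and `g`, paired differently.
    have hswap : ψ x * ψ y =
        ψ (fun v => if p v then x v else y v) * ψ (fun v => if p v then y v else x v) := by
      have h₁ (z w : ∀ v, A v) : (fun v : {v // p v} => if p v then z v else w v) =
          fun v : {v // p v} => z v := funext fun v => if_pos v.2
      have h₂ (z w : ∀ v, A v) : (fun v : {v // ¬ p v} => if p v then z v else w v) =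
          fun v : {v // ¬ p v} => w v := funext fun v => if_neg v.2
      simp only [h, h₁, h₂]
      ring
    have hre (z : ∀ v, A v) : (pureState ψ z z).re = ‖ψ z‖ ^ 2 := by
      simp only [pureState, Matrix.vecMulVec_apply, Pi.star_apply, RCLike.star_def,
        Complex.mul_conj, Complex.ofReal_re, Complex.normSq_eq_norm_sq]
    have hnorm := congrArg norm hswap
    rw [norm_mul, norm_mul] at hnorm
    rw [hre, hre, pureState, Matrix.vecMulVec_apply, norm_mul, Pi.star_apply, norm_star, hnorm,
      ← mul_assoc]
    exact two_mul_le_add_sq _ _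
  | zero => simp
  | add ρ σ _ _ h₁ h₂ =>
    -- The left side is subadditive in the state and the right side additive, so the bound survives
    -- mixing.
    simp only [Matrix.add_apply, Complex.add_re]
    linarith [norm_add_le (ρ x y) (σ x y)]

theorem ghzState_eq_zero {V : Type*} [Fintype V] {x : V → Fin 2} {u w : V} (h : x u ≠ x w) :
    ghzState V x = 0 := by
  have h₀ : ¬ ∀ v, x v = 0 := fun h' => h (by rw [h', h'])
  have h₁ : ¬ ∀ v, x v = 1 := fun h' => h (by rw [h', h'])
  simp [ghzState, h₀, h₁]

/-- The GHZ state is entangled across every nontrivial cut. -/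
theorem pureState_ghzState_notMem_separableCone {V : Type*} [Fintype V] {p : V → Prop} {u w : V}
    (hu : p u) (hw : ¬ p w) :
    pureState (ghzState V) ∉ separableCone (fun _ : V => Fin 2) p := by
  classical
  intro hmem
  have hle := two_mul_norm_apply_le_of_mem_separableCone hmem (fun _ => 0) (fun _ => 1)
  have : Nonempty V := ⟨u⟩
  simp only [pureState, Matrix.vecMulVec_apply] at hle
  have h₀₁ : ghzState V (fun v => if p v then 0 else 1) = 0 :=
    ghzState_eq_zero (u := u) (w := w) (by simp [hu, hw])
  have h₁₀ : ghzState V (fun v => if p v then 1 else 0) = 0 :=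
    ghzState_eq_zero (u := u) (w := w) (by simp [hu, hw])
  rw [h₀₁, h₁₀] at hle
  simp only [zero_mul, Complex.zero_re, add_zero] at hle
  have hpos : 0 < ‖ghzState V (fun _ => 0) * star (ghzState V) (fun _ => 1)‖ := by
    simp [ghzState]
  linarith

/-- The initial state is a product across any cut that no EPR pair crosses. -/
theorem EPRNetwork.isProductAcross_eprState {V : Type*} (N : EPRNetwork V) {p : V → Prop}
    (hp : ∀ e, p (N.left e) ↔ p (N.right e)) : IsProductAcross p N.eprState := by
  classical
  refine ⟨fun x => ∏ e : {e // p (N.left e)},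
      if x ⟨N.holder (e, 0), e.2⟩ ⟨(e, 0), rfl⟩ =
        x ⟨N.holder (e, 1), (hp e).1 e.2⟩ ⟨(e, 1), rfl⟩ then ((1 / Real.sqrt 2 : ℝ) : ℂ) else 0,
    fun x => ∏ e : {e // ¬ p (N.left e)},
      if x ⟨N.holder (e, 0), e.2⟩ ⟨(e, 0), rfl⟩ =
        x ⟨N.holder (e, 1), (hp e).not.1 e.2⟩ ⟨(e, 1), rfl⟩ then
          ((1 / Real.sqrt 2 : ℝ) : ℂ) else 0, fun x => ?_⟩
  -- Each pair lies wholly on the side of its left end, so the product over pairs splits.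
  exact (Fintype.prod_subtype_mul_prod_subtype (fun e => p (N.left e)) _).symm

theorem theorem3 {V : Type*} [Fintype V] [DecidableEq V] [Nonempty V] (N : EPRNetwork V)
    (h : N.CanPrepareGHZ) : N.eprGraph.Connected := by
  refine ⟨fun u w => ?_⟩
  by_contra huw
  obtain ⟨Φ, hΦ, hout⟩ := h
  have hp (e : Fin N.numPairs) :
      N.eprGraph.Reachable u (N.left e) ↔ N.eprGraph.Reachable u (N.right e) := by
    have hadj : N.eprGraph.Adj (N.left e) (N.right e) := ⟨e, Or.inl ⟨rfl, rfl⟩⟩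
    exact ⟨fun hr => hr.trans hadj.reachable, fun hr => hr.trans hadj.symm.reachable⟩
  have hmem := hΦ.mem_separableCone (N.eprGraph.Reachable u)
    (AddSubmonoid.subset_closure ⟨_, N.isProductAcross_eprState hp, rfl⟩)
  rw [hout] at hmem
  exact pureState_ghzState_notMem_separableCone (SimpleGraph.Reachable.refl u) huw hmem
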